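/- **Theorem (graph-norm control by the transport residual).** Let $D_{r}\subset\mathbb R^d$ be a bounded convex domain (its boundary is then automatically Lipschitz), let $S^{d-1}$ be the unit sphere of directions with surface measure $\mathrm d\Omega$, and let $D=D_r\times S^{d-1}$ with the measure $\mathrm dr\,\mathrm d\Omega$. Let $$W=\{\Psi\in L^2(D):\ \Omega\cdot\nabla_r\Psi\in L^2(D)\},\qquad \|\Psi\|_{\mathrm{gr}}=\bigl(\|\Psi\|_{L^2(D)}^2+\|\Omega\cdot\nabla_r\Psi\|_{L^2(D)}^2\bigr)^{1/2},$$ where $\Psi$ is real-valued and $\Omega\cdot\nabla_r\Psi$ is the distributional derivative on $D$. Let $n_r$ be the unit outward normal of $D_r$, which exists at almost every $r\in\partial D_r$ for the surface measure $\mathrm d\sigma$, and let $\Gamma^-=\{(r,\Omega)\in\partial D_r\times S^{d-1}: n_r\cdot\Omega<0\}$ be the inflow boundary. For $\Psi\in W$ the inflow trace $\gamma^-\Psi$ is defined for almost every $(r,\Omega)\in\Gamma^-$ (for the measure $|n_r\cdot\Omega|\,\mathrm d\sigma(r)\,\mathrm d\Omega$) as the boundary value along the characteristic that enters at $r$, $$\gamma^-\Psi(r,\Omega)=\operatorname*{ess\,lim}_{s\downarrow0}\Psi(r+s\Omega,\Omega).$$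 Put $W_0^-=\{\Psi\in W:\gamma^-\Psi=0 \text{ a.e. on }\Gamma^-\}$. Let $\Sigma_t$ be a measurable function on $D$ and $\sigma_*,\sigma^*$ real constants with $$0<\sigma_*\le\Sigma_t(r,\Omega)\le\sigma^*<\infty\quad\text{for a.e. }(r,\Omega)\in D,$$ and put $\mathcal D\Psi=\Omega\cdot\nabla_r\Psi+\Sigma_t\Psi$. Then for every $\Psi\in W_0^-$ one has $\mathcal D\Psi\in L^2(D)$, $$\|\Psi\|_{\mathrm{gr}}\le C_{\mathrm{gr}}\,\|\mathcal D\Psi\|_{L^2(D)},\qquad C_{\mathrm{gr}}=\Bigl[\sigma_*^{-2}+\Bigl(1+\frac{\sigma^*}{\sigma_*}\Bigr)^2\Bigr]^{1/2},$$ and conversely $$\|\mathcal D\Psi\|_{L^2(D)}\le(1+\sigma^*)\,\|\Psi\|_{\mathrm{gr}}.$$ Hence on $W_0^-$ the residual norm $\|\mathcal D\Psi\|_{L^2(D)}$ and the graph norm $\|\Psi\|_{\mathrm{gr}}$ are equivalent: there are constants $c,C>0$ with $c\,\|\Psi\|_{\mathrm{gr}}\le\|\mathcal D\Psi\|_{L^2(D)}\le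 C\,\|\Psi\|_{\mathrm{gr}}$ for all $\Psi\in W_0^-$. -/

import Mathlib

open MeasureTheory Filter Topology Metric
open scoped ContDiff RealInnerProductSpace

noncomputable section

namespace Transport

/-- Position space `ℝ^d` with its Euclidean norm. -/
abbrev Pos (d : ℕ) : Type := EuclideanSpace ℝ (Fin d)

/-- The unit sphere of directions `Ω ∈ S^{d-1} ⊂ ℝ^d`. -/
abbrev Dir (d : ℕ) : Type := sphere (0 : Pos d) 1

/-- The surface measure `dΩ` on the unit sphere. -/
def dirMeasure (d : ℕ) : Measure (Dir d) := (volume : Measure (Pos d)).toSphere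

/-- The measure `dr dΩ` on the phase space `D = D_r × S^{d-1}`. -/
def phaseMeasure {d : ℕ} (Dr : Set (Pos d)) : Measure (Pos d × Dir d) :=
  (volume.restrict Dr).prod (dirMeasure d)

/-- The `L²(D)` norm. -/
def l2Norm {d : ℕ} (Dr : Set (Pos d)) (f : Pos d × Dir d → ℝ) : ℝ :=
  (eLpNorm f 2 (phaseMeasure Dr)).toReal

/-- Test functions on `D`: restrictions to `D` of smooth compactly supported functions of
`(r, Ω) ∈ ℝ^d × ℝ^d` whose support lies over `D_r`. The restrictions are exactly the elements of
`C_c^∞(D_r × S^{d-1})`, because the sphere is a compact smooth submanifold. -/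
def IsTestFunction {d : ℕ} (Dr : Set (Pos d)) (φ : Pos d × Pos d → ℝ) : Prop :=
  ContDiff ℝ ∞ φ ∧ HasCompactSupport φ ∧ tsupport φ ⊆ Dr ×ˢ Set.univ

/-- `G = Ω·∇_r Ψ` in the sense of distributions on `D`. -/
def IsWeakStreaming {d : ℕ} (Dr : Set (Pos d)) (Ψ G : Pos d × Dir d → ℝ) : Prop :=
  ∀ φ : Pos d × Pos d → ℝ, IsTestFunction Dr φ →
    ∫ p, Ψ p * fderiv ℝ φ (p.1, (p.2 : Pos d)) ((p.2 : Pos d), 0) ∂(phaseMeasure Dr) =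
      -∫ p, G p * φ (p.1, (p.2 : Pos d)) ∂(phaseMeasure Dr)

/-- `Ψ` has a distributional streaming derivative that belongs to `L²(D)`. -/
def HasL2Streaming {d : ℕ} (Dr : Set (Pos d)) (Ψ : Pos d × Dir d → ℝ) : Prop :=
  ∃ G : Pos d × Dir d → ℝ, MemLp G 2 (phaseMeasure Dr) ∧ IsWeakStreaming Dr Ψ G

/-- The transport graph space `W = {Ψ ∈ L²(D) : Ω·∇_r Ψ ∈ L²(D)}`. -/
def graphSpace {d : ℕ} (Dr : Set (Pos d)) : Set (Pos d × Dir d → ℝ) :=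
  {Ψ | MemLp Ψ 2 (phaseMeasure Dr) ∧ HasL2Streaming Dr Ψ}

open Classical in
/-- The streaming derivative `Ω·∇_r Ψ ∈ L²(D)` (unique up to null sets). It is `0` by convention
when there is none, which does not happen on `graphSpace Dr`. -/
def streaming {d : ℕ} (Dr : Set (Pos d)) (Ψ : Pos d × Dir d → ℝ) : Pos d × Dir d → ℝ :=
  if h : HasL2Streaming Dr Ψ then h.choose else 0

/-- The graph norm `‖Ψ‖_gr = (‖Ψ‖² + ‖Ω·∇_r Ψ‖²)^{1/2}`. -/
def graphNorm {d : ℕ} (Dr : Set (Pos d)) (Ψ : Pos d × Dir d → ℝ) : ℝ :=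
  Real.sqrt (l2Norm Dr Ψ ^ 2 + l2Norm Dr (streaming Dr Ψ) ^ 2)

/-- The streaming-absorption operator `𝒟 Ψ = Ω·∇_r Ψ + Σ_t Ψ`. -/
def transportOp {d : ℕ} (Dr : Set (Pos d)) (Sigt Ψ : Pos d × Dir d → ℝ) :
    Pos d × Dir d → ℝ :=
  fun p => streaming Dr Ψ p + Sigt p * Ψ p

/-- `n` is a unit outward normal of the convex set `Dr` at the boundary point `r`. For surface-almost
every boundary point of a bounded convex domain there is exactly one, the classical normal. -/
def IsOutwardNormal {d : ℕ} (Dr : Set (Pos d)) (r n : Pos d) : Prop :=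
  ‖n‖ = 1 ∧ ∀ y ∈ Dr, ⟪n, y - r⟫ ≤ 0

/-- The inflow boundary `Γ⁻ = {(r, Ω) : r ∈ ∂D_r, n_r·Ω < 0}`. -/
def inflowBoundary {d : ℕ} (Dr : Set (Pos d)) : Set (Pos d × Dir d) :=
  {p | p.1 ∈ frontier Dr ∧ ∃ n, IsOutwardNormal Dr p.1 n ∧ ⟪n, (p.2 : Pos d)⟫ < 0}

/-- The surface measure on `∂D_r`: the `(d-1)`-dimensional Hausdorff measure. (Mathlib's
normalization differs from the usual one by a constant factor; only null sets are used below.) -/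
def surfaceMeasure {d : ℕ} (Dr : Set (Pos d)) : Measure (Pos d) :=
  (Measure.hausdorffMeasure ((d : ℝ) - 1)).restrict (frontier Dr)

/-- `γ⁻Ψ = g`: for almost every `(r, Ω) ∈ Γ⁻`, the value `g (r, Ω)` is the essential limit of
`s ↦ Ψ (r + s Ω, Ω)` as `s ↓ 0`, that is, the boundary value of `Ψ` along the characteristic which
enters `D_r` at `r`. On `Γ⁻` the weight `|n_r·Ω|` is positive, so that the measures `dσ dΩ` and
`|n_r·Ω| dσ dΩ` have the same null sets there; the null sets are read fibrewise, for almost every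
`Ω` and then almost every `r`. Changing `Ψ` on a null set of `D` does not matter. -/
def HasInflowTrace {d : ℕ} (Dr : Set (Pos d)) (Ψ g : Pos d × Dir d → ℝ) : Prop :=
  ∀ᵐ w ∂(dirMeasure d), ∀ᵐ r ∂(surfaceMeasure Dr), (r, w) ∈ inflowBoundary Dr →
    Tendsto (fun s : ℝ => Ψ (r + s • (w : Pos d), w)) (𝓝[>] 0 ⊓ ae volume) (𝓝 (g (r, w)))

/-- The homogeneous inflow space `W₀⁻ = {Ψ ∈ W : γ⁻Ψ = 0}`. -/
def zeroInflowSpace {d : ℕ} (Dr : Set (Pos d)) : Set (Pos d × Dir d → ℝ) :=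
  {Ψ | Ψ ∈ graphSpace Dr ∧ HasInflowTrace Dr Ψ 0}

/-- The constant `C_gr = [σ_*^{-2} + (1 + σ^*/σ_*)²]^{1/2}`. -/
def graphConst (sigLow sigUp : ℝ) : ℝ :=
  Real.sqrt ((sigLow ^ 2)⁻¹ + (1 + sigUp / sigLow) ^ 2)

end Transport

end

/-!
The inequality `‖𝒟Ψ‖ ≤ (1 + σ^*) ‖Ψ‖_gr` is the triangle inequality. For the other one it is enough
that streaming is accretive on `W₀⁻`, i.e. `∫ Ψ (Ω·∇Ψ) ≥ 0` (`integral_mul_streaming_nonneg`): then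
pointwise `σ_*² Ψ² + 2 σ_* Ψ (Ω·∇Ψ) ≤ (𝒟Ψ)²`, so that `σ_* ‖Ψ‖ ≤ ‖𝒟Ψ‖`, and `Ω·∇Ψ = 𝒟Ψ - Σ_t Ψ`
is bounded accordingly.

Accretivity is proved on characteristics, without a trace theorem or Green's formula. Let
`g = Ω·∇Ψ`, extended by zero, and let `F` be the integral of `g` over the characteristic up to the
present point (`backIntegral g`). By Fubini and the translation invariance of `dr dΩ`, `F` has the
weak streaming derivative `g` (`integral_streamDeriv_mul_backIntegral`). So `u = Ψ - F` has weak
streaming derivative zero; testing with shifted test functions shows that it is invariant under the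
free flight inside `D` (`ae_eq_shift_of_integral_streamDeriv_eq_zero`). At the entry point both `F`
and, by hypothesis, `Ψ` tend to zero, hence `u = 0`, i.e. `Ψ = F` (`ae_eq_backIntegral`). The
hypothesis speaks of surface-almost every entry point; a surface null set is missed by almost
every line of a given direction (`ae_forall_add_smul_notMem`), since orthogonal projection along
the direction is Lipschitz and maps it to a null set of a hyperplane.

Finally `∫ g F` is half of `∫ g H`, where `H` is the integral of `g` over the whole characteristic.
As `H` is constant on characteristics, `∫ g H` equals the integral of `H²` over a slab of unit
thickness across the characteristics, hence is nonnegative (`integral_mul_backIntegral_nonneg`).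
-/

noncomputable section

namespace Transport

variable {d : ℕ}

/-! ### Free flight along characteristics -/

instance : IsFiniteMeasure (dirMeasure d) := by
  unfold dirMeasure; infer_instance

/-- The measure `dr dΩ` on the whole of `ℝ^d × S^{d-1}`. -/
def fullMeasure (d : ℕ) : Measure (Pos d × Dir d) :=
  (volume : Measure (Pos d)).prod (dirMeasure d)

instance : SFinite (fullMeasure d) := by
  unfold fullMeasure; infer_instance

/-- The free flight `(r, Ω) ↦ (r + s Ω, Ω)` along characteristics. -/
def shift (s : ℝ) (p : Pos d × Dir d) : Pos d × Dir d := (p.1 + s • (p.2 : Pos d), p.2)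

/-- The part of phase space over a set of positions. -/
abbrev cylinder (Dr : Set (Pos d)) : Set (Pos d × Dir d) := Dr ×ˢ Set.univ

lemma phaseMeasure_eq_restrict (Dr : Set (Pos d)) :
    phaseMeasure Dr = (fullMeasure d).restrict (cylinder Dr) := by
  rw [phaseMeasure, fullMeasure, cylinder, ← Measure.prod_restrict, Measure.restrict_univ]

lemma fullMeasure_cylinder_lt_top {Dr : Set (Pos d)} (hbdd : Bornology.IsBounded Dr) :
    fullMeasure d (cylinder Dr) < ⊤ := by
  rw [fullMeasure, Measure.prod_prod]
  exact ENNReal.mul_lt_top hbdd.measure_lt_top (measure_lt_top _ _)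

lemma shift_shift (s t : ℝ) (p : Pos d × Dir d) : shift s (shift t p) = shift (s + t) p := by
  simp only [shift, add_smul, Prod.mk.injEq, and_true]; abel

@[simp] lemma shift_zero (p : Pos d × Dir d) : shift 0 p = p := by simp [shift]

@[simp] lemma shift_neg_shift (s : ℝ) (p : Pos d × Dir d) : shift (-s) (shift s p) = p := by
  simp [shift_shift]

@[simp] lemma shift_shift_neg (s : ℝ) (p : Pos d × Dir d) : shift s (shift (-s) p) = p := by
  simp [shift_shift]

lemma continuous_shift_uncurry :
    Continuous fun q : (Pos d × Dir d) × ℝ => shift q.2 q.1 := by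
  unfold shift; fun_prop

lemma continuous_shift (s : ℝ) : Continuous (shift s : Pos d × Dir d → Pos d × Dir d) := by
  unfold shift; fun_prop

lemma continuous_shift_left (p : Pos d × Dir d) : Continuous fun s : ℝ => shift s p := by
  unfold shift; fun_prop

lemma measurePreserving_shift (s : ℝ) :
    MeasurePreserving (shift s) (fullMeasure d) (fullMeasure d) := by
  have h : MeasurePreserving (fun q : Dir d × Pos d => (q.1, q.2 + s • (q.1 : Pos d)))
      ((dirMeasure d).prod volume) ((dirMeasure d).prod volume) :=
    (MeasurePreserving.id _).skew_product (g := fun (w : Dir d) (r : Pos d) => r + s • (w : Pos d))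
      (by unfold Function.uncurry; fun_prop)
      (ae_of_all _ fun w => (measurePreserving_add_right volume (s • (w : Pos d))).map_eq)
  exact (Measure.measurePreserving_swap.comp h).comp Measure.measurePreserving_swap

/-- Flow along the characteristic by the time coordinate and reverse that coordinate: a measure
preserving involution of phase space times the time axis. -/
lemma measurePreserving_shift_neg :
    MeasurePreserving (fun q : (Pos d × Dir d) × ℝ => (shift q.2 q.1, -q.2))
      ((fullMeasure d).prod volume) ((fullMeasure d).prod volume) := by
  have h : MeasurePreserving (fun q : ℝ × (Pos d × Dir d) => (-q.1, shift q.1 q.2))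
      ((volume : Measure ℝ).prod (fullMeasure d)) (volume.prod (fullMeasure d)) :=
    (Measure.measurePreserving_neg volume).skew_product
      (g := fun (s : ℝ) (p : Pos d × Dir d) => shift s p)
      (continuous_shift_uncurry.comp continuous_swap).measurable
      (ae_of_all _ fun s => (measurePreserving_shift s).map_eq)
  exact (Measure.measurePreserving_swap.comp h).comp Measure.measurePreserving_swap

lemma measurableEmbedding_shift_neg :
    MeasurableEmbedding (fun q : (Pos d × Dir d) × ℝ => (shift q.2 q.1, -q.2)) := by
  have hm : Measurable (fun q : (Pos d × Dir d) × ℝ => (shift q.2 q.1, -q.2)) :=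
    measurePreserving_shift_neg.measurable
  have hinv : Function.LeftInverse (fun q : (Pos d × Dir d) × ℝ => (shift q.2 q.1, -q.2))
      (fun q : (Pos d × Dir d) × ℝ => (shift q.2 q.1, -q.2)) := fun q => by simp
  exact (MeasurableEquiv.mk ⟨_, _, hinv, hinv⟩ hm hm).measurableEmbedding

lemma measurableEmbedding_shift (s : ℝ) :
    MeasurableEmbedding (shift s : Pos d × Dir d → Pos d × Dir d) :=
  (MeasurableEquiv.mk ⟨shift s, shift (-s), fun p => by simp, fun p => by simp⟩
    (continuous_shift s).measurable (continuous_shift (-s)).measurable).measurableEmbedding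

/-- A property which holds almost everywhere on phase space holds, from almost every starting
point, at almost every time along the characteristic. -/
lemma ae_ae_shift {P : Pos d × Dir d → Prop} (h : ∀ᵐ p ∂(fullMeasure d), P p) :
    ∀ᵐ p ∂(fullMeasure d), ∀ᵐ s : ℝ, P (shift s p) :=
  Measure.ae_ae_of_ae_prod
    ((Measure.quasiMeasurePreserving_fst.comp
      measurePreserving_shift_neg.quasiMeasurePreserving).ae h)

/-- Almost everywhere on phase space, read fibrewise: for almost every direction and then almost
every position. -/
lemma ae_dir_ae_pos {P : Pos d × Dir d → Prop} (h : ∀ᵐ p ∂(fullMeasure d), P p) :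
    ∀ᵐ w ∂(dirMeasure d), ∀ᵐ r : Pos d, P (r, w) :=
  Measure.ae_ae_of_ae_prod (p := fun q : Dir d × Pos d => P (q.2, q.1))
    (Measure.measurePreserving_swap.quasiMeasurePreserving.ae h)

lemma ae_of_ae_dir_ae_pos {P : Pos d × Dir d → Prop} (hP : MeasurableSet {p | P p})
    (h : ∀ᵐ w ∂(dirMeasure d), ∀ᵐ r : Pos d, P (r, w)) : ∀ᵐ p ∂(fullMeasure d), P p := by
  rw [fullMeasure, Measure.ae_prod_iff_ae_ae hP]
  exact (Measure.ae_ae_comm (p := fun r w => P (r, w)) hP).2 h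

/-- Two points of a bounded set on one characteristic have bounded time distance. -/
lemma exists_abs_le_of_shift_mem {Dr : Set (Pos d)} (hbdd : Bornology.IsBounded Dr) :
    ∃ M : ℝ, ∀ (p : Pos d × Dir d) (s : ℝ), p.1 ∈ Dr → (shift s p).1 ∈ Dr → |s| ≤ M := by
  obtain ⟨M, hM⟩ := hbdd.exists_norm_le
  refine ⟨M + M, fun p s h₀ h₁ => ?_⟩
  have h := norm_sub_le (shift s p).1 p.1
  have hw : ‖(p.2 : Pos d)‖ = 1 := by simp
  simp only [shift, add_sub_cancel_left, norm_smul, hw, mul_one, Real.norm_eq_abs] at h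
  have h1 := hM _ h₁
  simp only [shift] at h1
  linarith [hM _ h₀]

/-- The integral over a characteristic up to the present point. -/
def backIntegral (g : Pos d × Dir d → ℝ) (p : Pos d × Dir d) : ℝ :=
  ∫ τ in Set.Iic (0 : ℝ), g (shift τ p)

/-- The integral over a characteristic from the present point on. -/
def forwardIntegral (g : Pos d × Dir d → ℝ) (p : Pos d × Dir d) : ℝ :=
  ∫ τ in Set.Ici (0 : ℝ), g (shift τ p)

/-- The integral over a whole characteristic. -/
def lineIntegral (g : Pos d × Dir d → ℝ) (p : Pos d × Dir d) : ℝ :=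
  ∫ τ : ℝ, g (shift τ p)

lemma stronglyMeasurable_comp_shift {g : Pos d × Dir d → ℝ} (hg : StronglyMeasurable g) :
    StronglyMeasurable fun q : (Pos d × Dir d) × ℝ => g (shift q.2 q.1) :=
  hg.comp_measurable continuous_shift_uncurry.measurable

lemma stronglyMeasurable_backIntegral {g : Pos d × Dir d → ℝ} (hg : StronglyMeasurable g) :
    StronglyMeasurable (backIntegral g) :=
  (stronglyMeasurable_comp_shift hg).integral_prod_right

lemma lineIntegral_shift (g : Pos d × Dir d → ℝ) (s : ℝ) (p : Pos d × Dir d) :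
    lineIntegral g (shift s p) = lineIntegral g p := by
  simp only [lineIntegral, shift_shift]
  exact integral_add_right_eq_self (fun τ => g (shift τ p)) s

lemma backIntegral_shift (g : Pos d × Dir d → ℝ) (s : ℝ) (p : Pos d × Dir d) :
    backIntegral g (shift s p) = ∫ τ in Set.Iic s, g (shift τ p) := by
  have h := (measurePreserving_add_right (volume : Measure ℝ) s).setIntegral_preimage_emb
    (measurableEmbedding_addRight s) (fun τ => g (shift τ p)) (Set.Iic s)
  rw [← h]
  simp [backIntegral, shift_shift]

/-- Two square integrable functions supported over a bounded set, one of them transported along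
the characteristics, have an integrable product. -/
lemma integrable_mul_shift {Dr : Set (Pos d)} (hbdd : Bornology.IsBounded Dr)
    {f g : Pos d × Dir d → ℝ} (hfm : StronglyMeasurable f) (hgm : StronglyMeasurable g)
    (hf : MemLp f 2 (fullMeasure d)) (hg : MemLp g 2 (fullMeasure d))
    (hf0 : ∀ p, p.1 ∉ Dr → f p = 0) (hg0 : ∀ p, p.1 ∉ Dr → g p = 0) :
    Integrable (fun q : (Pos d × Dir d) × ℝ => f q.1 * g (shift q.2 q.1))
      ((fullMeasure d).prod volume) := by
  obtain ⟨M, hM⟩ := exists_abs_le_of_shift_mem hbdd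
  have hc : Integrable (Set.indicator (Set.Icc (-M) M) (fun _ : ℝ => (1 : ℝ))) :=
    (integrable_indicator_iff measurableSet_Icc).2 (integrableOn_const (by simp))
  have h1 := hf.integrable_sq.mul_prod hc
  have h2 := measurePreserving_shift_neg.integrable_comp_of_integrable
    (hg.integrable_sq.mul_prod hc)
  refine (h1.add h2).mono' (((hfm.comp_measurable measurable_fst).mul
    (stronglyMeasurable_comp_shift hgm)).aestronglyMeasurable) (ae_of_all _ fun q => ?_)
  have hpos : 0 ≤ Set.indicator (Set.Icc (-M) M) (fun _ : ℝ => (1 : ℝ)) q.2 :=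
    Set.indicator_nonneg (fun _ _ => zero_le_one) _
  have hneg : Set.indicator (Set.Icc (-M) M) (fun _ : ℝ => (1 : ℝ)) (-q.2) =
      Set.indicator (Set.Icc (-M) M) (fun _ : ℝ => (1 : ℝ)) q.2 := by
    simp only [Set.indicator, Set.mem_Icc]
    congr 1
    exact propext ⟨fun h => ⟨by linarith, by linarith⟩, fun h => ⟨by linarith, by linarith⟩⟩
  simp only [Pi.add_apply, Function.comp_apply, hneg, Real.norm_eq_abs]
  by_cases h : q.1.1 ∈ Dr ∧ (shift q.2 q.1).1 ∈ Dr
  · have hq : q.2 ∈ Set.Icc (-M) M := abs_le.1 (hM q.1 q.2 h.1 h.2)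
    rw [Set.indicator_of_mem hq, mul_one, mul_one, abs_mul]
    nlinarith [sq_abs (f q.1), sq_abs (g (shift q.2 q.1)),
      sq_nonneg (|f q.1| - |g (shift q.2 q.1)|), sq_nonneg (|f q.1| + |g (shift q.2 q.1)|)]
  · have h0 : f q.1 * g (shift q.2 q.1) = 0 := by
      rcases not_and_or.1 h with h | h
      · rw [hf0 _ h, zero_mul]
      · rw [hg0 _ h, mul_zero]
    rw [h0, abs_zero]
    positivity

lemma integrable_mul_setIntegral_shift {f g : Pos d × Dir d → ℝ}
    (h : Integrable (fun q : (Pos d × Dir d) × ℝ => f q.1 * g (shift q.2 q.1))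
      ((fullMeasure d).prod volume)) (s : Set ℝ) :
    Integrable (fun p => f p * ∫ τ in s, g (shift τ p)) (fullMeasure d) := by
  have e : (fullMeasure d).prod (volume.restrict s) =
      ((fullMeasure d).prod volume).restrict (Set.univ ×ˢ s) := by
    rw [← Measure.prod_restrict, Measure.restrict_univ]
  have h' : Integrable (fun q : (Pos d × Dir d) × ℝ => f q.1 * g (shift q.2 q.1))
      ((fullMeasure d).prod (volume.restrict s)) := e ▸ h.restrict
  refine h'.integral_prod_left.congr (ae_of_all _ fun p => ?_)
  simp only [integral_const_mul]

/-- Integration backward and integration forward along characteristics are adjoint. -/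
lemma integral_mul_backIntegral {f g : Pos d × Dir d → ℝ}
    (h : Integrable (fun q : (Pos d × Dir d) × ℝ => f q.1 * g (shift q.2 q.1))
      ((fullMeasure d).prod volume)) :
    ∫ p, f p * backIntegral g p ∂(fullMeasure d) =
      ∫ p, g p * forwardIntegral f p ∂(fullMeasure d) := by
  set K : (Pos d × Dir d) × ℝ → ℝ :=
    (Set.univ ×ˢ Set.Iic (0 : ℝ)).indicator fun q => f q.1 * g (shift q.2 q.1) with hK
  have hs : MeasurableSet ((Set.univ : Set (Pos d × Dir d)) ×ˢ Set.Iic (0 : ℝ)) :=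
    MeasurableSet.univ.prod measurableSet_Iic
  have hKi : Integrable K ((fullMeasure d).prod volume) := h.indicator hs
  have h1 : ∫ p, f p * backIntegral g p ∂(fullMeasure d) =
      ∫ q, K q ∂((fullMeasure d).prod volume) := by
    rw [integral_prod _ hKi]
    congr 1 with p
    rw [backIntegral, ← integral_const_mul, ← integral_indicator measurableSet_Iic]
    congr 1 with τ
    simp [hK, Set.indicator]
  have hKi' := measurePreserving_shift_neg.integrable_comp_of_integrable hKi
  rw [h1, ← measurePreserving_shift_neg.integral_comp measurableEmbedding_shift_neg]
  refine (integral_prod _ hKi').trans ?_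
  congr 1 with p
  rw [forwardIntegral, ← integral_const_mul, ← integral_indicator measurableSet_Ici]
  congr 1 with τ
  simp [hK, Set.indicator, mul_comm]

/-- The energy of the flux produced by a source: half the integral of `source × (line integral of
the source)`, which is nonnegative because the line integral is constant on characteristics. -/
lemma integral_mul_backIntegral_nonneg {g : Pos d × Dir d → ℝ}
    (hgm : StronglyMeasurable g)
    (h : Integrable (fun q : (Pos d × Dir d) × ℝ => g q.1 * g (shift q.2 q.1))
      ((fullMeasure d).prod volume)) :
    0 ≤ ∫ p, g p * backIntegral g p ∂(fullMeasure d) := by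
  have hint : Integrable (fun p => g p * lineIntegral g p) (fullMeasure d) := by
    refine h.integral_prod_left.congr (ae_of_all _ fun p => ?_)
    simp only [lineIntegral, integral_const_mul]
  have hae : ∀ᵐ p ∂(fullMeasure d), Integrable fun τ : ℝ => g p * g (shift τ p) :=
    h.prod_right_ae
  have hback : Integrable (fun p => g p * backIntegral g p) (fullMeasure d) :=
    integrable_mul_setIntegral_shift h _
  have hforw : Integrable (fun p => g p * forwardIntegral g p) (fullMeasure d) :=
    integrable_mul_setIntegral_shift h _
  have htwo : 2 * ∫ p, g p * backIntegral g p ∂(fullMeasure d) =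
      ∫ p, g p * lineIntegral g p ∂(fullMeasure d) := by
    rw [two_mul]
    nth_rewrite 2 [integral_mul_backIntegral h]
    rw [← integral_add hback hforw]
    refine integral_congr_ae ?_
    filter_upwards [hae] with p hp
    simp only [lineIntegral, backIntegral, forwardIntegral, ← integral_const_mul]
    rw [integral_Ici_eq_integral_Ioi]
    exact intervalIntegral.integral_Iic_add_Ioi hp.integrableOn hp.integrableOn
  -- Weight with the indicator of a slab of unit thickness across the characteristics: its
  -- integral over each characteristic is one.
  set X : Pos d × Dir d → ℝ := fun p =>
    (Set.Ico (0 : ℝ) 1).indicator (fun _ => (1 : ℝ)) ⟪p.1, (p.2 : Pos d)⟫ with hX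
  have hXm : StronglyMeasurable X := by
    have : Measurable fun p : Pos d × Dir d => ⟪p.1, (p.2 : Pos d)⟫ :=
      (continuous_fst.inner (continuous_subtype_val.comp continuous_snd)).measurable
    exact ((measurable_const.indicator measurableSet_Ico).comp this).stronglyMeasurable
  have hX0 : ∀ p, 0 ≤ X p := fun p => Set.indicator_nonneg (fun _ _ => zero_le_one) _
  have hXshift : ∀ (p : Pos d × Dir d) (τ : ℝ), X (shift τ p) =
      (Set.Ico (0 : ℝ) 1).indicator (fun _ => (1 : ℝ)) (⟪p.1, (p.2 : Pos d)⟫ + τ) := by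
    intro p τ
    have hw : ‖(p.2 : Pos d)‖ = 1 := by simp
    simp [hX, shift, inner_add_left, inner_smul_left, hw]
  have hIco : Integrable (Set.indicator (Set.Ico (0 : ℝ) 1) (fun _ : ℝ => (1 : ℝ))) :=
    (integrable_indicator_iff measurableSet_Ico).2 (integrableOn_const (by simp))
  have hXint : ∀ p : Pos d × Dir d, Integrable fun τ : ℝ => X (shift τ p) := fun p => by
    simp only [hXshift]; exact hIco.comp_add_left _
  have hXone : ∀ p : Pos d × Dir d, ∫ τ : ℝ, X (shift τ p) = 1 := fun p => by
    simp only [hXshift]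
    rw [integral_add_left_eq_self (fun t => (Set.Ico (0 : ℝ) 1).indicator (fun _ => (1 : ℝ)) t),
      integral_indicator measurableSet_Ico]
    simp
  have hgl : StronglyMeasurable fun p => g p * lineIntegral g p :=
    hgm.mul (stronglyMeasurable_comp_shift hgm).integral_prod_right
  have hL : Integrable (fun q : (Pos d × Dir d) × ℝ =>
      (g q.1 * lineIntegral g q.1) * X (shift q.2 q.1)) ((fullMeasure d).prod volume) := by
    have hm : StronglyMeasurable fun q : (Pos d × Dir d) × ℝ =>
        (g q.1 * lineIntegral g q.1) * X (shift q.2 q.1) :=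
      (hgl.comp_measurable measurable_fst).mul (stronglyMeasurable_comp_shift hXm)
    refine (integrable_prod_iff hm.aestronglyMeasurable).2
      ⟨ae_of_all _ fun p => (hXint p).const_mul (g p * lineIntegral g p), ?_⟩
    refine hint.norm.congr (ae_of_all _ fun p => ?_)
    simp only [norm_mul, integral_const_mul]
    simp only [Real.norm_of_nonneg (hX0 _), hXone, mul_one]
  have hL' := measurePreserving_shift_neg.integrable_comp_of_integrable hL
  have hfinal : ∫ p, g p * lineIntegral g p ∂(fullMeasure d) =
      ∫ p, X p * lineIntegral g p ^ 2 ∂(fullMeasure d) := by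
    calc ∫ p, g p * lineIntegral g p ∂(fullMeasure d)
        = ∫ q : (Pos d × Dir d) × ℝ, (g q.1 * lineIntegral g q.1) * X (shift q.2 q.1)
            ∂((fullMeasure d).prod volume) := by
          rw [integral_prod _ hL]
          simp only [integral_const_mul, hXone, mul_one]
      _ = _ := by
          rw [← measurePreserving_shift_neg.integral_comp measurableEmbedding_shift_neg]
          refine (integral_prod _ hL').trans ?_
          congr 1 with p
          simp only [Function.comp_apply, lineIntegral_shift, shift_neg_shift]
          rw [integral_mul_const, integral_mul_const]
          change lineIntegral g p * _ * _ = _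
          ring
  have : 0 ≤ ∫ p, X p * lineIntegral g p ^ 2 ∂(fullMeasure d) :=
    integral_nonneg fun p => mul_nonneg (hX0 p) (sq_nonneg _)
  linarith

/-! ### Weak streaming derivatives and test functions -/

instance : IsFiniteMeasureOnCompacts (fullMeasure d) := by
  unfold fullMeasure; infer_instance

/-- The inclusion of phase space `ℝ^d × S^{d-1}` into `ℝ^d × ℝ^d`, where test functions live. -/
def ambient (p : Pos d × Dir d) : Pos d × Pos d := (p.1, (p.2 : Pos d))

lemma isClosedEmbedding_ambient : IsClosedEmbedding (ambient : Pos d × Dir d → Pos d × Pos d) :=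
  IsClosedEmbedding.id.prodMap (isClosed_sphere.isClosedEmbedding_subtypeVal)

/-- The classical streaming derivative `Ω·∇_r φ` of a function on `ℝ^d × ℝ^d`. -/
def streamDeriv (φ : Pos d × Pos d → ℝ) (p : Pos d × Dir d) : ℝ :=
  fderiv ℝ φ (ambient p) ((p.2 : Pos d), 0)

lemma hasDerivAt_comp_shift {φ : Pos d × Pos d → ℝ} (hφ : ContDiff ℝ ∞ φ) (p : Pos d × Dir d)
    (τ : ℝ) :
    HasDerivAt (fun t => φ (ambient (shift t p))) (streamDeriv φ (shift τ p)) τ := by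
  have h1 : HasDerivAt (fun t : ℝ => ambient (shift t p)) ((p.2 : Pos d), 0) τ := by
    have h : HasDerivAt (fun t : ℝ => p.1 + t • (p.2 : Pos d)) (p.2 : Pos d) τ := by
      simpa using ((hasDerivAt_id τ).smul_const (p.2 : Pos d)).const_add p.1
    exact h.prodMk (hasDerivAt_const τ (p.2 : Pos d))
  exact ((hφ.differentiable (by simp)) _).hasFDerivAt.comp_hasDerivAt τ h1

lemma continuous_streamDeriv {φ : Pos d × Pos d → ℝ} (hφ : ContDiff ℝ ∞ φ) :
    Continuous (streamDeriv φ) := by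
  have h1 : Continuous fun p : Pos d × Dir d => fderiv ℝ φ (ambient p) :=
    (hφ.continuous_fderiv (by simp)).comp isClosedEmbedding_ambient.continuous
  exact h1.clm_apply (by fun_prop)

lemma streamDeriv_eq_zero {φ : Pos d × Pos d → ℝ} {p : Pos d × Dir d}
    (h : ambient p ∉ tsupport φ) : streamDeriv φ p = 0 := by
  have : fderiv ℝ φ (ambient p) = 0 := by
    by_contra h0
    exact h (support_fderiv_subset ℝ h0)
  simp [streamDeriv, this]

lemma hasCompactSupport_streamDeriv {φ : Pos d × Pos d → ℝ} (hφ : HasCompactSupport φ) :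
    HasCompactSupport (streamDeriv φ) :=
  HasCompactSupport.intro (isClosedEmbedding_ambient.isCompact_preimage hφ)
    fun _ hp => streamDeriv_eq_zero hp

lemma isClosedEmbedding_ambient_shift (p : Pos d × Dir d) :
    IsClosedEmbedding fun τ : ℝ => ambient (shift τ p) := by
  refine Isometry.isClosedEmbedding (Isometry.of_dist_eq fun s t => ?_)
  have hw : ‖(p.2 : Pos d)‖ = 1 := by simp
  simp [ambient, shift, dist_eq_norm, ← sub_smul, norm_smul, hw]

lemma forwardIntegral_streamDeriv {φ : Pos d × Pos d → ℝ} (hφ : ContDiff ℝ ∞ φ)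
    (hc : HasCompactSupport φ) (p : Pos d × Dir d) :
    forwardIntegral (streamDeriv φ) p = -φ (ambient p) := by
  have hsm : ContDiff ℝ 1 fun t : ℝ => φ (ambient (shift t p)) := by
    refine (hφ.of_le (by simp)).comp ?_
    exact (by fun_prop : ContDiff ℝ 1 fun t : ℝ => (p.1 + t • (p.2 : Pos d), (p.2 : Pos d)))
  have h := HasCompactSupport.integral_Ioi_deriv_eq hsm
    (hc.comp_isClosedEmbedding (isClosedEmbedding_ambient_shift p)) 0
  rw [shift_zero] at h
  rw [← h, forwardIntegral, integral_Ici_eq_integral_Ioi]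
  simp only [(hasDerivAt_comp_shift hφ p _).deriv]

/-- The integral of a source up to the present point has the source as its weak streaming
derivative. -/
lemma integral_streamDeriv_mul_backIntegral {Dr : Set (Pos d)} (hbdd : Bornology.IsBounded Dr)
    {φ : Pos d × Pos d → ℝ} (hφ : IsTestFunction Dr φ) {g : Pos d × Dir d → ℝ}
    (hgm : StronglyMeasurable g) (hg : MemLp g 2 (fullMeasure d))
    (hg0 : ∀ p, p.1 ∉ Dr → g p = 0) :
    ∫ p, streamDeriv φ p * backIntegral g p ∂(fullMeasure d) =
      -∫ p, g p * φ (ambient p) ∂(fullMeasure d) := by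
  obtain ⟨hsm, hc, hsupp⟩ := hφ
  have hcont := continuous_streamDeriv hsm
  rw [integral_mul_backIntegral (integrable_mul_shift hbdd hcont.stronglyMeasurable hgm
    (hcont.memLp_of_hasCompactSupport (hasCompactSupport_streamDeriv hc)) hg
    (fun p hp => streamDeriv_eq_zero fun h => hp (hsupp h).1) hg0), ← integral_neg]
  simp only [forwardIntegral_streamDeriv hsm hc, mul_neg]

/-- The shift of `ℝ^d × ℝ^d` which extends the free flight by time `-τ`. -/
def ambientShift (τ : ℝ) : (Pos d × Pos d) ≃ₜ (Pos d × Pos d) where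
  toFun x := (x.1 - τ • x.2, x.2)
  invFun x := (x.1 + τ • x.2, x.2)
  left_inv x := by simp
  right_inv x := by simp
  continuous_toFun := by fun_prop
  continuous_invFun := by fun_prop

lemma contDiff_ambientShift (τ : ℝ) :
    ContDiff ℝ ∞ (ambientShift τ : Pos d × Pos d → Pos d × Pos d) := by
  change ContDiff ℝ ∞ fun x : Pos d × Pos d => (x.1 - τ • x.2, x.2)
  fun_prop

lemma ambientShift_ambient (τ : ℝ) (p : Pos d × Dir d) :
    ambientShift τ (ambient p) = ambient (shift (-τ) p) := by
  simp [ambientShift, ambient, shift, sub_eq_add_neg]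

/-- A test function whose support stays over a convex set when it is shifted by time `s` remains
a test function at all intermediate times. -/
lemma isTestFunction_comp_ambientShift {Dr : Set (Pos d)} (hconv : Convex ℝ Dr)
    {φ : Pos d × Pos d → ℝ} (hφ : ContDiff ℝ ∞ φ) (hc : HasCompactSupport φ) {s : ℝ}
    (hsupp : tsupport φ ⊆ {x | x.1 ∈ Dr ∧ x.1 + s • x.2 ∈ Dr}) {τ : ℝ} (hτ : τ ∈ Set.uIcc 0 s) :
    IsTestFunction Dr (φ ∘ ambientShift τ) := by
  refine ⟨hφ.comp (contDiff_ambientShift τ),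
    hc.comp_homeomorph _, fun x hx => ⟨?_, trivial⟩⟩
  have hx' : ambientShift τ x ∈ tsupport φ :=
    tsupport_comp_subset_preimage φ (ambientShift τ).continuous hx
  obtain ⟨h0, h1⟩ := hsupp hx'
  have hline : Convex ℝ {t : ℝ | (ambientShift τ x).1 + t • x.2 ∈ Dr} := by
    have := hconv.affine_preimage (AffineMap.lineMap (k := ℝ) (ambientShift τ x).1
      ((ambientShift τ x).1 + x.2))
    simpa [AffineMap.lineMap_apply, add_comm, Set.preimage] using this
  have hmem := hline.ordConnected.uIcc_subset (by simpa using h0) h1 hτ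
  simpa [ambientShift] using hmem

lemma streamDeriv_comp_ambientShift {φ : Pos d × Pos d → ℝ} (hφ : ContDiff ℝ ∞ φ) (τ : ℝ)
    (p : Pos d × Dir d) :
    streamDeriv (φ ∘ ambientShift τ) p = streamDeriv φ (shift (-τ) p) := by
  have h1 := hasDerivAt_comp_shift (φ := φ ∘ ambientShift τ)
    (hφ.comp (contDiff_ambientShift τ)) p 0
  have h2 := hasDerivAt_comp_shift hφ (shift (-τ) p) 0
  simp only [Function.comp_apply, ambientShift_ambient, shift_shift, shift_zero,
    zero_add, add_comm (-τ)] at h1 h2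
  exact h1.unique h2

/-- A function without weak streaming derivative is invariant under the free flight, inside a
convex domain. -/
lemma ae_eq_shift_of_integral_streamDeriv_eq_zero {Dr : Set (Pos d)} (hopen : IsOpen Dr)
    (hconv : Convex ℝ Dr) {u : Pos d × Dir d → ℝ}
    (hui : Integrable u (fullMeasure d))
    (hu : ∀ φ, IsTestFunction Dr φ → ∫ p, u p * streamDeriv φ p ∂(fullMeasure d) = 0) (s : ℝ) :
    ∀ᵐ p ∂(fullMeasure d), p.1 ∈ Dr → (shift s p).1 ∈ Dr → u (shift s p) = u p := by
  have hus : Integrable (fun p => u (shift s p)) (fullMeasure d) :=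
    (measurePreserving_shift s).integrable_comp_of_integrable hui
  set U : Set (Pos d × Pos d) := {x | x.1 ∈ Dr ∧ x.1 + s • x.2 ∈ Dr} with hU
  have hUo : IsOpen U := (hopen.preimage continuous_fst).inter
    (hopen.preimage (by fun_prop : Continuous fun x : Pos d × Pos d => x.1 + s • x.2))
  have key : ∀ φ : Pos d × Pos d → ℝ, ContDiff ℝ ∞ φ → HasCompactSupport φ → tsupport φ ⊆ U →
      ∫ p, φ (ambient p) * (u (shift s p) - u p) ∂(fullMeasure d) = 0 := by
    intro φ hφ hc hsupp
    have hcont := continuous_streamDeriv hφ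
    obtain ⟨C, hC⟩ := hcont.bounded_above_of_compact_support (hasCompactSupport_streamDeriv hc)
    obtain ⟨C', hC'⟩ := hφ.continuous.bounded_above_of_compact_support hc
    have hφc : Continuous fun p : Pos d × Dir d => φ (ambient p) :=
      hφ.continuous.comp isClosedEmbedding_ambient.continuous
    have : IsFiniteMeasure (volume.restrict (Set.uIoc 0 s)) :=
      ⟨by simp [Set.uIoc]⟩
    have hFub : Integrable (Function.uncurry fun (τ : ℝ) (p : Pos d × Dir d) =>
        u p * streamDeriv φ (shift (-τ) p))
        ((volume.restrict (Set.uIoc 0 s)).prod (fullMeasure d)) := by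
      have h2 : Continuous fun q : ℝ × (Pos d × Dir d) => streamDeriv φ (shift (-q.1) q.2) :=
        hcont.comp (continuous_shift_uncurry.comp
          (continuous_snd.prodMk (continuous_neg.comp continuous_fst)))
      exact (hui.comp_snd (volume.restrict (Set.uIoc 0 s))).mul_bdd (c := C) h2.aestronglyMeasurable
        (ae_of_all _ fun q => hC _)
    have hline : ∀ p : Pos d × Dir d, ∫ τ in (0 : ℝ)..s, streamDeriv φ (shift (-τ) p) =
        φ (ambient p) - φ (ambient (shift (-s) p)) := by
      intro p
      rw [intervalIntegral.integral_comp_neg (fun τ => streamDeriv φ (shift τ p)), neg_zero,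
        intervalIntegral.integral_eq_sub_of_hasDerivAt
          (fun τ _ => hasDerivAt_comp_shift hφ p τ)
          ((hcont.comp (continuous_shift_left p)).intervalIntegrable _ _), shift_zero]
    have h0 : ∫ p, u p * (φ (ambient p) - φ (ambient (shift (-s) p))) ∂(fullMeasure d) = 0 := by
      simp only [← hline, ← intervalIntegral.integral_const_mul]
      rw [← intervalIntegral_integral_swap hFub]
      refine (intervalIntegral.integral_congr fun τ hτ => ?_).trans
        intervalIntegral.integral_zero
      have := hu _ (isTestFunction_comp_ambientShift hconv hφ hc hsupp hτ)
      simpa only [streamDeriv_comp_ambientShift hφ] using this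
    have hi1 : Integrable (fun p => u p * φ (ambient p)) (fullMeasure d) :=
      hui.mul_bdd (c := C') hφc.aestronglyMeasurable (ae_of_all _ fun p => hC' _)
    have hi2 : Integrable (fun p => u p * φ (ambient (shift (-s) p))) (fullMeasure d) :=
      hui.mul_bdd (c := C') (hφc.comp (continuous_shift _)).aestronglyMeasurable
        (ae_of_all _ fun p => hC' _)
    have hi3 : Integrable (fun p => u (shift s p) * φ (ambient p)) (fullMeasure d) :=
      hus.mul_bdd (c := C') hφc.aestronglyMeasurable (ae_of_all _ fun p => hC' _)
    have hmove : ∫ p, u p * φ (ambient (shift (-s) p)) ∂(fullMeasure d) =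
        ∫ p, u (shift s p) * φ (ambient p) ∂(fullMeasure d) := by
      rw [← (measurePreserving_shift s).integral_comp (measurableEmbedding_shift s)]
      simp
    simp only [mul_sub] at h0
    rw [integral_sub hi1 hi2, hmove] at h0
    simp only [mul_comm (φ _), sub_mul]
    rw [integral_sub hi3 hi1]
    linarith
  have hemb : MeasurableEmbedding (ambient : Pos d × Dir d → Pos d × Pos d) :=
    isClosedEmbedding_ambient.measurableEmbedding
  -- Transfer the vanishing difference to `ℝ^d × ℝ^d` with the image measure.
  set f : Pos d × Pos d → ℝ :=
    Function.extend ambient (fun p => u (shift s p) - u p) 0 with hf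
  have hfa : ∀ p, f (ambient p) = u (shift s p) - u p := fun p =>
    hemb.injective.extend_apply _ _ _
  have hfi : Integrable f ((fullMeasure d).map ambient) := by
    rw [hemb.integrable_map_iff]
    exact (hus.sub hui).congr (ae_of_all _ fun p => (hfa p).symm)
  have hae := hUo.ae_eq_zero_of_integral_contDiff_smul_eq_zero
    (hfi.locallyIntegrable.locallyIntegrableOn U) (fun φ hφ hc hsupp => by
      rw [hemb.integral_map]
      simpa only [smul_eq_mul, hfa] using key φ hφ hc hsupp)
  rw [hemb.ae_map_iff] at hae
  filter_upwards [hae] with p hp h0 h1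
  have := hp ⟨h0, h1⟩
  rw [hfa] at this
  linarith

/-! ### Entry points on the inflow boundary -/

/-- A set of vanishing surface measure is missed by almost every line of a given direction: its
orthogonal projection along that direction is again null. -/
lemma ae_forall_add_smul_notMem {N : Set (Pos d)}
    (hN : Measure.hausdorffMeasure ((d : ℝ) - 1) N = 0) (w : Dir d) :
    ∀ᵐ r : Pos d, ∀ t : ℝ, r + t • (w : Pos d) ∉ N := by
  have hw : (w : Pos d) ≠ 0 := ne_zero_of_mem_unit_sphere w
  -- The existence of a direction forces `d ≥ 1`.
  obtain ⟨n, rfl⟩ : ∃ n, d = n + 1 := by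
    refine Nat.exists_eq_succ_of_ne_zero fun h0 => hw ?_
    subst h0
    exact Subsingleton.elim _ _
  have : Fact (Module.finrank ℝ (Pos (n + 1)) = n + 1) := ⟨by simp⟩
  set F := (ℝ ∙ (w : Pos (n + 1)))ᗮ with hF
  have hfin : Module.finrank ℝ F = n := Submodule.finrank_orthogonal_span_singleton hw
  set L : Pos (n + 1) →L[ℝ] F := F.orthogonalProjectionOnto with hL
  have hLw : ∀ r : Pos (n + 1), ∀ t : ℝ, L (r + t • (w : Pos (n + 1))) = L r := fun r t => by
    have : L (w : Pos (n + 1)) = 0 :=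
      Submodule.orthogonalProjectionOnto_orthogonal_apply_eq_zero (Submodule.mem_span_singleton_self _)
    simp [this]
  have hsurj : Function.Surjective (L : Pos (n + 1) →ₗ[ℝ] F) := fun y =>
    ⟨y, Submodule.orthogonalProjectionOnto_mem_subspace_eq_self y⟩
  have himg : Measure.hausdorffMeasure (Module.finrank ℝ F : ℝ) (L '' N) = 0 := by
    have h := (L.lipschitz).hausdorffMeasure_image_le (d := (n : ℝ)) (Nat.cast_nonneg n) N
    have hN' : Measure.hausdorffMeasure (n : ℝ) N = 0 := by simpa using hN
    rw [hN', mul_zero] at h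
    rw [hfin]
    exact le_antisymm h zero_le
  have hae := (ae_comp_linearMap_mem_iff (L : Pos (n + 1) →ₗ[ℝ] F) volume
    (Measure.hausdorffMeasure (Module.finrank ℝ F : ℝ)) hsurj
    (measurableSet_toMeasurable (Measure.hausdorffMeasure (Module.finrank ℝ F : ℝ))
      (L '' N)).compl).2 (by
      rw [← measure_toMeasurable] at himg
      exact measure_eq_zero_iff_ae_notMem.1 himg)
  filter_upwards [hae] with r hr t ht
  exact hr (subset_toMeasurable _ _ ⟨_, ht, hLw r t⟩)

/-- The characteristic through a point of a bounded convex domain enters the domain at a boundary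
point, at a negative time `a`. -/
lemma exists_entry {Dr : Set (Pos d)} (hopen : IsOpen Dr) (hconv : Convex ℝ Dr)
    (hbdd : Bornology.IsBounded Dr) {p : Pos d × Dir d} (hp : p.1 ∈ Dr) :
    ∃ a < 0, (shift a p).1 ∈ frontier Dr ∧ (∀ s ∈ Set.Ioc a 0, (shift s p).1 ∈ Dr) ∧
      ∀ s ≤ a, (shift s p).1 ∉ Dr := by
  obtain ⟨M, hM⟩ := exists_abs_le_of_shift_mem hbdd
  have hc : Continuous fun s : ℝ => (shift s p).1 :=
    continuous_fst.comp (continuous_shift_left p)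
  set A : Set ℝ := {s | s ≤ 0 ∧ (shift s p).1 ∉ Dr} with hA
  have hAc : IsClosed A := isClosed_Iic.inter (hopen.preimage hc).isClosed_compl
  have hAb : BddAbove A := ⟨0, fun s hs => hs.1⟩
  have hAne : A.Nonempty := by
    refine ⟨-(|M| + 1), by linarith [abs_nonneg M], fun h => ?_⟩
    have := hM p _ hp h
    rw [abs_neg, abs_of_nonneg (by positivity)] at this
    linarith [le_abs_self M]
  have haA : sSup A ∈ A := hAc.csSup_mem hAne hAb
  have ha0 : sSup A < 0 := lt_of_le_of_ne haA.1 fun h => by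
    have := haA.2
    rw [h, shift_zero] at this
    exact this hp
  have hin : ∀ s ∈ Set.Ioc (sSup A) 0, (shift s p).1 ∈ Dr := fun s hs => by
    by_contra h
    exact absurd (le_csSup hAb (show s ∈ A from ⟨hs.2, h⟩)) (not_le.2 hs.1)
  have hline : Convex ℝ {t : ℝ | (shift t p).1 ∈ Dr} := by
    have := hconv.affine_preimage (AffineMap.lineMap (k := ℝ) p.1 (p.1 + (p.2 : Pos d)))
    simpa [AffineMap.lineMap_apply, add_comm, Set.preimage, shift] using this
  refine ⟨sSup A, ha0, ⟨?_, fun h => haA.2 (interior_subset h)⟩, hin, fun s hs h => haA.2 ?_⟩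
  · refine mem_closure_of_tendsto (f := fun s : ℝ => (shift s p).1) (b := 𝓝[>] (sSup A))
      (hc.tendsto _ |>.mono_left nhdsWithin_le_nhds) ?_
    filter_upwards [Ioc_mem_nhdsGT ha0] with s hs using hin s hs
  · exact hline.ordConnected.out h (show (shift 0 p).1 ∈ Dr by simpa using hp) ⟨hs, ha0.le⟩

/-- The entry point of a characteristic which meets the domain lies on the inflow boundary: the
direction of flight is strictly inward there. -/
lemma shift_mem_inflowBoundary {Dr : Set (Pos d)} (hopen : IsOpen Dr) (hconv : Convex ℝ Dr)
    {p : Pos d × Dir d} (hp : p.1 ∈ Dr) {a : ℝ} (ha : a < 0)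
    (hfr : (shift a p).1 ∈ frontier Dr) : shift a p ∈ inflowBoundary Dr := by
  have hnot : (shift a p).1 ∉ Dr := fun h => by
    rw [hopen.frontier_eq] at hfr
    exact hfr.2 h
  obtain ⟨f, hf⟩ := geometric_hahn_banach_open_point hconv hopen hnot
  obtain ⟨v, rfl⟩ := (InnerProductSpace.toDual ℝ (Pos d)).surjective f
  simp only [InnerProductSpace.toDual_apply_apply] at hf
  have hv : v ≠ 0 := by
    rintro rfl
    simpa using hf _ hp
  have hv' : 0 < ‖v‖ := norm_pos_iff.2 hv
  refine ⟨hfr, ‖v‖⁻¹ • v, ⟨by simp [norm_smul, hv'.ne'], fun y hy => ?_⟩, ?_⟩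
  · rw [real_inner_smul_left, inner_sub_right]
    exact mul_nonpos_of_nonneg_of_nonpos (by positivity) (by linarith [hf y hy])
  · have h := hf _ hp
    simp only [shift, inner_add_right, real_inner_smul_right] at h ⊢
    rw [real_inner_smul_left]
    refine mul_neg_of_pos_of_neg (by positivity) ?_
    nlinarith

/-- The filter of essential right limits is proper. -/
instance neBot_nhdsGT_inf_ae (a : ℝ) : NeBot (𝓝[>] a ⊓ ae (volume : Measure ℝ)) := by
  refine inf_neBot_iff.2 fun {U} hU {V} hV => ?_
  obtain ⟨b, hb, hbU⟩ := (mem_nhdsGT_iff_exists_Ioo_subset).1 hU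
  by_contra hne
  have hsub : Set.Ioo a b ⊆ Vᶜ := fun x hx hxV => hne ⟨x, hbU hx, hxV⟩
  have h0 : volume (Set.Ioo a b) = 0 := measure_mono_null hsub hV
  rw [Real.volume_Ioo, ENNReal.ofReal_eq_zero] at h0
  exact absurd (Set.mem_Ioi.1 hb) (not_lt.2 (by linarith))

/-- Along one characteristic: if `Ψ` differs from the integral of the source by a constant `c` and
its essential limit at the entry point vanishes, then `c = 0`. -/
lemma eq_zero_of_tendsto_entry {Dr : Set (Pos d)} {Ψ g : Pos d × Dir d → ℝ}
    {p : Pos d × Dir d} {a c : ℝ} (ha : a < 0)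
    (hin : ∀ s ∈ Set.Ioc a 0, (shift s p).1 ∈ Dr) (hout : ∀ s ≤ a, (shift s p).1 ∉ Dr)
    (hg0 : ∀ q, q.1 ∉ Dr → g q = 0) (hint : Integrable fun τ : ℝ => g (shift τ p))
    (hΨ : ∀ᵐ s : ℝ, (shift s p).1 ∈ Dr → Ψ (shift s p) = backIntegral g (shift s p) + c)
    (htr : Tendsto (fun s : ℝ => Ψ ((shift a p).1 + s • (p.2 : Pos d), p.2))
      (𝓝[>] 0 ⊓ ae volume) (𝓝 0)) : c = 0 := by
  have hshift : ∀ s : ℝ, ((shift a p).1 + s • (p.2 : Pos d), p.2) = shift (s + a) p := fun s => by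
    rw [← shift_shift]; rfl
  simp only [hshift] at htr
  have hback : Tendsto (fun s : ℝ => backIntegral g (shift (s + a) p))
      (𝓝[>] 0 ⊓ ae volume) (𝓝 0) := by
    have h1 : ∀ s : ℝ, backIntegral g (shift (s + a) p) = ∫ τ in a..(s + a), g (shift τ p) := by
      intro s
      rw [backIntegral_shift, ← intervalIntegral.integral_Iic_sub_Iic hint.integrableOn
        hint.integrableOn, setIntegral_eq_zero_of_forall_eq_zero (t := Set.Iic a)
        (fun τ hτ => hg0 _ (hout τ hτ)), sub_zero]
    simp only [h1]
    have h2 : Continuous fun s : ℝ => ∫ τ in a..(s + a), g (shift τ p) :=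
      (intervalIntegral.continuous_primitive (fun _ _ => hint.intervalIntegrable) a).comp
        (continuous_id.add continuous_const)
    have h3 := h2.tendsto 0
    simp only [zero_add, intervalIntegral.integral_same] at h3
    exact h3.mono_left (inf_le_left.trans nhdsWithin_le_nhds)
  have hev : ∀ᶠ s in 𝓝[>] (0 : ℝ) ⊓ ae volume,
      backIntegral g (shift (s + a) p) + c = Ψ (shift (s + a) p) := by
    have e1 : ∀ᶠ s in 𝓝[>] (0 : ℝ), s ∈ Set.Ioc 0 (-a) := Ioc_mem_nhdsGT (by linarith)
    have e2 := (measurePreserving_add_right (volume : Measure ℝ) a).quasiMeasurePreserving.ae hΨ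
    filter_upwards [e1.filter_mono inf_le_left, e2.filter_mono inf_le_right] with s h1 h2
    exact (h2 (hin _ ⟨by linarith [h1.1], by linarith [h1.2]⟩)).symm
  have hlim := (hback.add_const c).congr' hev
  simpa using tendsto_nhds_unique hlim htr

/-! ### The energy inequality and the graph norm -/

/-- A square integrable function with square integrable weak streaming derivative `g` and vanishing
inflow trace is the integral of `g` along characteristics, from the inflow boundary on. -/
theorem ae_eq_backIntegral {Dr : Set (Pos d)} (hopen : IsOpen Dr) (hconv : Convex ℝ Dr)
    (hbdd : Bornology.IsBounded Dr) {Ψ g : Pos d × Dir d → ℝ}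
    (hΨ : MemLp Ψ 2 (phaseMeasure Dr)) (htr : HasInflowTrace Dr Ψ 0)
    (hgm : StronglyMeasurable g) (hg : MemLp g 2 (fullMeasure d))
    (hg0 : ∀ p, p.1 ∉ Dr → g p = 0) (hweak : IsWeakStreaming Dr Ψ g) :
    Ψ =ᵐ[phaseMeasure Dr] backIntegral g := by
  have hcyl : MeasurableSet (cylinder Dr) := hopen.measurableSet.prod MeasurableSet.univ
  have hfin : fullMeasure d (cylinder Dr) < ⊤ := fullMeasure_cylinder_lt_top hbdd
  have : IsFiniteMeasure (phaseMeasure Dr) := by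
    rw [phaseMeasure_eq_restrict]; exact ⟨by simpa using hfin⟩
  obtain ⟨Ψ', hΨ'm, hΨΨ'⟩ := hΨ.1
  have hFm := stronglyMeasurable_backIntegral hgm
  set one : Pos d × Dir d → ℝ := (cylinder Dr).indicator fun _ => 1 with hone
  have hprod := integrable_mul_shift hbdd
    ((stronglyMeasurable_const (b := (1 : ℝ))).indicator hcyl) hgm
    (memLp_indicator_const 2 hcyl (1 : ℝ) (Or.inr hfin.ne)) hg
    (fun p hp => Set.indicator_of_notMem (fun h => hp h.1) _) hg0
  have hFint : Integrable (fun p => one p * backIntegral g p) (fullMeasure d) :=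
    integrable_mul_setIntegral_shift hprod _
  have hΨint : Integrable (fun p => one p * Ψ' p) (fullMeasure d) := by
    have h1 : IntegrableOn Ψ' (cylinder Dr) (fullMeasure d) := by
      rw [IntegrableOn, ← phaseMeasure_eq_restrict]
      exact (hΨ.ae_eq hΨΨ').integrable (by norm_num)
    refine (h1.integrable_indicator hcyl).congr (ae_of_all _ fun p => ?_)
    by_cases hp : p ∈ cylinder Dr <;> simp [hone, hp]
  set u : Pos d × Dir d → ℝ := fun p => one p * Ψ' p - one p * backIntegral g p with hu
  have hum : StronglyMeasurable u := by
    have h1 := (stronglyMeasurable_const (β := ℝ) (b := (1 : ℝ))).indicator hcyl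
    exact (h1.mul hΨ'm).sub (h1.mul hFm)
  have huin : ∀ p, p.1 ∈ Dr → u p = Ψ' p - backIntegral g p := fun p hp => by
    have : one p = 1 := Set.indicator_of_mem (show p ∈ cylinder Dr from ⟨hp, trivial⟩) _
    simp [hu, this]
  have huweak : ∀ φ, IsTestFunction Dr φ → ∫ p, u p * streamDeriv φ p ∂(fullMeasure d) = 0 := by
    intro φ hφ
    have hcont := continuous_streamDeriv hφ.1
    obtain ⟨C, hC⟩ := hcont.bounded_above_of_compact_support
      (hasCompactSupport_streamDeriv hφ.2.1)
    have hφ0 : ∀ p : Pos d × Dir d, p ∉ cylinder Dr → ambient p ∉ tsupport φ := fun p hp h =>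
      hp ⟨(hφ.2.2 h).1, trivial⟩
    have hone' : ∀ p, one p * streamDeriv φ p = streamDeriv φ p := fun p => by
      by_cases hp : p ∈ cylinder Dr
      · simp [hone, hp]
      · simp [streamDeriv_eq_zero (hφ0 p hp)]
    have e1 : ∫ p, one p * Ψ' p * streamDeriv φ p ∂(fullMeasure d) =
        -∫ p, g p * φ (ambient p) ∂(fullMeasure d) := by
      have h := hweak φ hφ
      have hl : ∫ p, Ψ p * streamDeriv φ p ∂(phaseMeasure Dr) =
          ∫ p, one p * Ψ' p * streamDeriv φ p ∂(fullMeasure d) := by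
        have h' : ∫ p, Ψ p * streamDeriv φ p ∂(phaseMeasure Dr) =
            ∫ p, Ψ' p * streamDeriv φ p ∂(phaseMeasure Dr) :=
          integral_congr_ae (hΨΨ'.mul (ae_eq_refl (streamDeriv φ)))
        rw [h', phaseMeasure_eq_restrict,
          setIntegral_eq_integral_of_forall_compl_eq_zero]
        · congr 1 with p
          rw [mul_right_comm, mul_comm, hone' p]
        · intro p hp
          simp [streamDeriv_eq_zero (hφ0 p hp)]
      rw [← hl]
      refine h.trans ?_
      rw [phaseMeasure_eq_restrict, setIntegral_eq_integral_of_forall_compl_eq_zero]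
      · rfl
      · intro p hp
        rw [hg0 p fun h => hp ⟨h, trivial⟩, zero_mul]
    have e2 := integral_streamDeriv_mul_backIntegral hbdd hφ hgm hg hg0
    have e3 : ∫ p, one p * backIntegral g p * streamDeriv φ p ∂(fullMeasure d) =
        -∫ p, g p * φ (ambient p) ∂(fullMeasure d) := by
      rw [← e2]
      congr 1 with p
      rw [mul_right_comm, hone' p]
    simp only [hu, sub_mul]
    rw [integral_sub (hΨint.mul_bdd (c := C) hcont.aestronglyMeasurable (ae_of_all _ hC))
      (hFint.mul_bdd (c := C) hcont.aestronglyMeasurable (ae_of_all _ hC)), e1, e3, sub_self]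
  -- `u` is constant along almost every characteristic.
  have hconst : ∀ᵐ p ∂(fullMeasure d), ∀ᵐ s : ℝ, p.1 ∈ Dr → (shift s p).1 ∈ Dr →
      u (shift s p) = u p := by
    have hD : MeasurableSet {q : (Pos d × Dir d) × ℝ | q.1.1 ∈ Dr} :=
      hopen.measurableSet.preimage (measurable_fst.comp measurable_fst)
    have hDs : MeasurableSet {q : (Pos d × Dir d) × ℝ | (shift q.2 q.1).1 ∈ Dr} :=
      hopen.measurableSet.preimage (measurable_fst.comp continuous_shift_uncurry.measurable)
    have heq : MeasurableSet {q : (Pos d × Dir d) × ℝ | u (shift q.2 q.1) = u q.1} :=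
      measurableSet_eq_fun (stronglyMeasurable_comp_shift hum).measurable
        (hum.measurable.comp measurable_fst)
    refine (Measure.ae_ae_comm (p := fun (p : Pos d × Dir d) (s : ℝ) =>
      p.1 ∈ Dr → (shift s p).1 ∈ Dr → u (shift s p) = u p) (hD.imp (hDs.imp heq))).2 ?_
    exact ae_of_all _ fun s =>
      ae_eq_shift_of_integral_streamDeriv_eq_zero hopen hconv (hΨint.sub hFint) huweak s
  have hrep : ∀ᵐ p ∂(fullMeasure d), p.1 ∈ Dr → Ψ p = Ψ' p := by
    have h := hΨΨ'
    rw [phaseMeasure_eq_restrict] at h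
    filter_upwards [(ae_restrict_iff' hcyl).1 h] with p hp hpD using hp ⟨hpD, trivial⟩
  have hzero : ∀ᵐ p ∂(fullMeasure d), p.1 ∈ Dr → u p = 0 := by
    refine ae_of_ae_dir_ae_pos ((hopen.measurableSet.preimage measurable_fst).imp
      (hum.measurable (measurableSet_singleton 0))) ?_
    -- The trace condition is only available fibrewise in the direction.
    filter_upwards [htr, ae_dir_ae_pos hconst, ae_dir_ae_pos (ae_ae_shift hrep),
      ae_dir_ae_pos hprod.prod_right_ae] with w hw1 hw2 hw3 hw4
    rw [surfaceMeasure, ae_restrict_iff' isClosed_frontier.measurableSet] at hw1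
    filter_upwards [hw2, hw3, hw4, ae_forall_add_smul_notMem hw1 w] with r h2 h3 h4 h1 hr
    obtain ⟨a, ha, hfr, hin, hout⟩ := exists_entry (p := (r, w)) hopen hconv hbdd hr
    refine eq_zero_of_tendsto_entry (Ψ := Ψ) (p := (r, w)) ha hin hout hg0 ?_ ?_ ?_
    · simpa [hr] using h4
    · filter_upwards [h2, h3] with s hs2 hs3 hs
      have := hs2 hr hs
      rw [huin _ hs] at this
      rw [hs3 hs]
      linarith
    · have h := not_not.1 (h1 a)
      exact h hfr (shift_mem_inflowBoundary (p := (r, w)) hopen hconv hr ha hfr)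
  rw [phaseMeasure_eq_restrict]
  refine (ae_restrict_iff' hcyl).2 ?_
  filter_upwards [hzero, hrep] with p h1 h2 hp
  have h3 := h1 hp.1
  rw [huin _ hp.1] at h3
  rw [h2 hp.1]
  linarith

/-- The energy inequality: streaming is accretive on functions with vanishing inflow trace. -/
theorem integral_mul_streaming_nonneg {Dr : Set (Pos d)} (hopen : IsOpen Dr) (hconv : Convex ℝ Dr)
    (hbdd : Bornology.IsBounded Dr) {Ψ G : Pos d × Dir d → ℝ}
    (hΨ : MemLp Ψ 2 (phaseMeasure Dr)) (htr : HasInflowTrace Dr Ψ 0)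
    (hG : MemLp G 2 (phaseMeasure Dr)) (hweak : IsWeakStreaming Dr Ψ G) :
    0 ≤ ∫ p, G p * Ψ p ∂(phaseMeasure Dr) := by
  have hcyl : MeasurableSet (cylinder Dr) := hopen.measurableSet.prod MeasurableSet.univ
  obtain ⟨G', hG'm, hGG'⟩ := hG.1
  set g : Pos d × Dir d → ℝ := (cylinder Dr).indicator G' with hgdef
  have hgm : StronglyMeasurable g := hG'm.indicator hcyl
  have hg0 : ∀ p, p.1 ∉ Dr → g p = 0 := fun p hp => Set.indicator_of_notMem (fun h => hp h.1) _
  have hGg : G =ᵐ[phaseMeasure Dr] g := by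
    refine hGG'.trans ?_
    rw [phaseMeasure_eq_restrict]
    exact (indicator_ae_eq_restrict hcyl).symm
  have hg : MemLp g 2 (fullMeasure d) := by
    have h := hG.ae_eq hGG'
    rw [phaseMeasure_eq_restrict] at h
    exact (memLp_indicator_iff_restrict hcyl).2 h
  have hweak' : IsWeakStreaming Dr Ψ g := fun φ hφ => by
    rw [hweak φ hφ]
    congr 1
    exact integral_congr_ae (hGg.mul (ae_eq_refl fun p : Pos d × Dir d => φ (p.1, (p.2 : Pos d))))
  have hback := ae_eq_backIntegral hopen hconv hbdd hΨ htr hgm hg hg0 hweak'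
  have hint : ∫ p, G p * Ψ p ∂(phaseMeasure Dr) =
      ∫ p, g p * backIntegral g p ∂(phaseMeasure Dr) := integral_congr_ae (hGg.mul hback)
  rw [hint, phaseMeasure_eq_restrict,
    setIntegral_eq_integral_of_forall_compl_eq_zero
      (fun p hp => by simp [hg0 p fun h => hp ⟨h, trivial⟩])]
  exact integral_mul_backIntegral_nonneg hgm (integrable_mul_shift hbdd hgm hgm hg hg hg0 hg0)

lemma l2Norm_nonneg (Dr : Set (Pos d)) (f : Pos d × Dir d → ℝ) : 0 ≤ l2Norm Dr f :=
  ENNReal.toReal_nonneg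

lemma l2Norm_sq {Dr : Set (Pos d)} {f : Pos d × Dir d → ℝ} (hf : MemLp f 2 (phaseMeasure Dr)) :
    l2Norm Dr f ^ 2 = ∫ p, f p ^ 2 ∂(phaseMeasure Dr) := by
  have hI : 0 ≤ ∫ p, f p ^ 2 ∂(phaseMeasure Dr) := integral_nonneg fun _ => sq_nonneg _
  rw [l2Norm, hf.eLpNorm_eq_integral_rpow_norm (by norm_num) (by norm_num)]
  simp only [ENNReal.toReal_ofNat, Real.rpow_ofNat, Real.norm_eq_abs, sq_abs]
  rw [ENNReal.toReal_ofReal (by positivity), ← Real.rpow_natCast, ← Real.rpow_mul hI]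
  norm_num

lemma l2Norm_add_le {Dr : Set (Pos d)} {f g : Pos d × Dir d → ℝ}
    (hf : MemLp f 2 (phaseMeasure Dr)) (hg : MemLp g 2 (phaseMeasure Dr)) :
    l2Norm Dr (f + g) ≤ l2Norm Dr f + l2Norm Dr g := by
  unfold l2Norm
  rw [← ENNReal.toReal_add hf.eLpNorm_ne_top hg.eLpNorm_ne_top]
  exact ENNReal.toReal_mono (ENNReal.add_ne_top.2 ⟨hf.eLpNorm_ne_top, hg.eLpNorm_ne_top⟩)
    (eLpNorm_add_le hf.1 hg.1 (by norm_num))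

lemma l2Norm_le_mul {Dr : Set (Pos d)} {f g : Pos d × Dir d → ℝ} {c : ℝ} (hc : 0 ≤ c)
    (hg : MemLp g 2 (phaseMeasure Dr)) (h : ∀ᵐ p ∂(phaseMeasure Dr), ‖f p‖ ≤ c * ‖g p‖) :
    l2Norm Dr f ≤ c * l2Norm Dr g := by
  have h1 := ENNReal.toReal_mono (ENNReal.mul_ne_top ENNReal.ofReal_ne_top hg.eLpNorm_ne_top)
    (eLpNorm_le_mul_eLpNorm_of_ae_le_mul h 2)
  rwa [ENNReal.toReal_mul, ENNReal.toReal_ofReal hc] at h1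

/-- The two graph-norm bounds for one function of `W₀⁻`. -/
theorem graphNorm_bounds {Dr : Set (Pos d)} (hopen : IsOpen Dr) (hconv : Convex ℝ Dr)
    (hbdd : Bornology.IsBounded Dr) {Sigt : Pos d × Dir d → ℝ}
    (hmeas : AEStronglyMeasurable Sigt (phaseMeasure Dr)) {sigLow sigUp : ℝ} (hpos : 0 < sigLow)
    (hbounds : ∀ᵐ p ∂(phaseMeasure Dr), sigLow ≤ Sigt p ∧ Sigt p ≤ sigUp)
    {Ψ : Pos d × Dir d → ℝ} (hΨ : Ψ ∈ zeroInflowSpace Dr) :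
    MemLp (transportOp Dr Sigt Ψ) 2 (phaseMeasure Dr) ∧
      graphNorm Dr Ψ ≤ graphConst sigLow sigUp * l2Norm Dr (transportOp Dr Sigt Ψ) ∧
      l2Norm Dr (transportOp Dr Sigt Ψ) ≤ (1 + sigUp) * graphNorm Dr Ψ := by
  obtain ⟨⟨hΨ2, hstr⟩, htr⟩ := hΨ
  obtain ⟨hG, hweak⟩ : MemLp (streaming Dr Ψ) 2 (phaseMeasure Dr) ∧
      IsWeakStreaming Dr Ψ (streaming Dr Ψ) := by
    rw [streaming, dif_pos hstr]; exact hstr.choose_spec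
  set G := streaming Dr Ψ with hGdef
  have hSΨbd : ∀ᵐ p ∂(phaseMeasure Dr), ‖Sigt p * Ψ p‖ ≤ sigUp * ‖Ψ p‖ := by
    filter_upwards [hbounds] with p hp
    rw [norm_mul, Real.norm_of_nonneg (by linarith [hp.1])]
    exact mul_le_mul_of_nonneg_right hp.2 (norm_nonneg _)
  have hSΨ : MemLp (fun p => Sigt p * Ψ p) 2 (phaseMeasure Dr) :=
    hΨ2.of_le_mul (hmeas.mul hΨ2.1) hSΨbd
  have hD : MemLp (transportOp Dr Sigt Ψ) 2 (phaseMeasure Dr) := hG.add hSΨ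
  refine ⟨hD, ?_⟩
  -- On a null phase space the upper bound `sigUp` may be negative, but all norms vanish.
  rcases eq_or_ne (phaseMeasure Dr) 0 with h0 | h0
  · simp [graphNorm, l2Norm, h0]
  have hup : 0 < sigUp := by
    have : NeBot (ae (phaseMeasure Dr)) := ae_neBot.2 h0
    obtain ⟨p, hp⟩ := hbounds.exists
    linarith [hp.1, hp.2]
  set A := l2Norm Dr Ψ with hA
  set B := l2Norm Dr G with hB
  set R := l2Norm Dr (transportOp Dr Sigt Ψ) with hR
  have hA0 : 0 ≤ A := l2Norm_nonneg _ _
  have hB0 : 0 ≤ B := l2Norm_nonneg _ _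
  have hR0 : 0 ≤ R := l2Norm_nonneg _ _
  have hSA : l2Norm Dr (fun p => Sigt p * Ψ p) ≤ sigUp * A := l2Norm_le_mul hup.le hΨ2 hSΨbd
  have hRle : R ≤ B + sigUp * A := (l2Norm_add_le hG hSΨ).trans (by linarith)
  have hBle : B ≤ R + sigUp * A := by
    have h1 := l2Norm_add_le hD hSΨ.neg
    have h2 : transportOp Dr Sigt Ψ + -(fun p => Sigt p * Ψ p) = G := by
      funext p; simp [transportOp, hGdef]
    have h3 : l2Norm Dr (-(fun p => Sigt p * Ψ p)) = l2Norm Dr (fun p => Sigt p * Ψ p) := by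
      rw [l2Norm, eLpNorm_neg, l2Norm]
    rw [h2, h3] at h1
    linarith
  have hAR : sigLow * A ≤ R := by
    have hacc := integral_mul_streaming_nonneg hopen hconv hbdd hΨ2 htr hG hweak
    have hGΨ : Integrable (fun p => G p * Ψ p) (phaseMeasure Dr) := hG.integrable_mul hΨ2
    -- `σ² Ψ² + 2 σ Ψ (Ω·∇Ψ) ≤ (𝒟Ψ)²` pointwise, by `2 x y ≤ x² + y²` with
    -- `x = σ Ψ` and `y = 𝒟Ψ`.
    have hle : ∫ p, (sigLow ^ 2 * Ψ p ^ 2 + 2 * sigLow * (G p * Ψ p)) ∂(phaseMeasure Dr) ≤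
        ∫ p, transportOp Dr Sigt Ψ p ^ 2 ∂(phaseMeasure Dr) := by
      refine integral_mono_ae ((hΨ2.integrable_sq.const_mul _).add (hGΨ.const_mul _))
        hD.integrable_sq ?_
      filter_upwards [hbounds] with p hp
      have h1 : 0 ≤ sigLow * ((Sigt p - sigLow) * Ψ p ^ 2) :=
        mul_nonneg hpos.le (mul_nonneg (by linarith [hp.1]) (sq_nonneg _))
      have h2 : transportOp Dr Sigt Ψ p = G p + Sigt p * Ψ p := rfl
      simp only [h2]
      nlinarith [sq_nonneg (G p + Sigt p * Ψ p - sigLow * Ψ p)]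
    rw [integral_add (hΨ2.integrable_sq.const_mul _) (hGΨ.const_mul _), integral_const_mul,
      integral_const_mul, ← l2Norm_sq hΨ2, ← l2Norm_sq hD] at hle
    have h3 : 0 ≤ 2 * sigLow * ∫ p, G p * Ψ p ∂(phaseMeasure Dr) := by positivity
    refine le_of_sq_le_sq ?_ hR0
    rw [mul_pow]
    linarith
  have hA' : A ≤ sigLow⁻¹ * R := by
    rw [inv_mul_eq_div, le_div_iff₀ hpos]; linarith
  have hB' : B ≤ (1 + sigUp / sigLow) * R := by
    have : sigUp * A ≤ sigUp * (sigLow⁻¹ * R) := mul_le_mul_of_nonneg_left hA' hup.le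
    calc B ≤ R + sigUp * (sigLow⁻¹ * R) := by linarith
      _ = _ := by ring
  constructor
  · rw [graphNorm, graphConst]
    refine Real.sqrt_le_iff.2 ⟨by positivity, ?_⟩
    rw [mul_pow, Real.sq_sqrt (by positivity), add_mul, ← inv_pow, ← mul_pow, ← mul_pow]
    gcongr
  · have h1 : A ≤ graphNorm Dr Ψ := Real.le_sqrt_of_sq_le (by simp only [← hA]; nlinarith)
    have h2 : B ≤ graphNorm Dr Ψ := Real.le_sqrt_of_sq_le (by nlinarith)
    nlinarith

end Transport

end

theorem theorem1 {d : ℕ} (Dr : Set (Transport.Pos d))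
    (hopen : IsOpen Dr) (hconv : Convex ℝ Dr) (hbdd : Bornology.IsBounded Dr)
    (Sigt : Transport.Pos d × Transport.Dir d → ℝ)
    (hmeas : AEStronglyMeasurable Sigt (Transport.phaseMeasure Dr))
    (sigLow sigUp : ℝ) (hpos : 0 < sigLow)
    (hbounds : ∀ᵐ p ∂(Transport.phaseMeasure Dr), sigLow ≤ Sigt p ∧ Sigt p ≤ sigUp) :
    (∀ Ψ ∈ Transport.zeroInflowSpace Dr,
      MemLp (Transport.transportOp Dr Sigt Ψ) 2 (Transport.phaseMeasure Dr) ∧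
      Transport.graphNorm Dr Ψ ≤
        Transport.graphConst sigLow sigUp *
          Transport.l2Norm Dr (Transport.transportOp Dr Sigt Ψ) ∧
      Transport.l2Norm Dr (Transport.transportOp Dr Sigt Ψ) ≤
        (1 + sigUp) * Transport.graphNorm Dr Ψ) ∧
    (∃ c : ℝ, 0 < c ∧ ∃ C : ℝ, 0 < C ∧ ∀ Ψ ∈ Transport.zeroInflowSpace Dr,
      c * Transport.graphNorm Dr Ψ ≤ Transport.l2Norm Dr (Transport.transportOp Dr Sigt Ψ) ∧
      Transport.l2Norm Dr (Transport.transportOp Dr Sigt Ψ) ≤ C * Transport.graphNorm Dr Ψ) := by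
  have hmain := fun Ψ (hΨ : Ψ ∈ Transport.zeroInflowSpace Dr) =>
    Transport.graphNorm_bounds hopen hconv hbdd hmeas hpos hbounds hΨ
  refine ⟨hmain, ?_⟩
  have hgc : 0 < Transport.graphConst sigLow sigUp :=
    Real.sqrt_pos.2 (by positivity)
  refine ⟨(Transport.graphConst sigLow sigUp)⁻¹, inv_pos.2 hgc, |1 + sigUp| + 1, by positivity,
    fun Ψ hΨ => ⟨?_, ?_⟩⟩
  · rw [inv_mul_le_iff₀ hgc]
    exact (hmain Ψ hΨ).2.1
  · refine (hmain Ψ hΨ).2.2.trans (mul_le_mul_of_nonneg_right ?_ (Real.sqrt_nonneg _))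
    linarith [le_abs_self (1 + sigUp)]
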